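/- The equation $$3^n\pm(n^3+n)=x^2$$ has exactly one solution in positive integers $n,x$ and a choice of sign, namely $3^1-(1^3+1)=1^2$. That is, there are no positive integers $n,x$ with $3^n+(n^3+n)=x^2$, and for positive integers $n,x$ one has $3^n-(n^3+n)=x^2$ if and only if $n=1$ and $x=1$. -/

import Mathlib

/-! For `n < 1381`, apart from the solution itself, each value is negative or a quadratic nonresidue
modulo a small prime, by computation. For `n ≥ 1381`, every square other than `3 ^ n` itself is
farther than `n ^ 3 + n` from `3 ^ n`. If `n = 2k`, this is the gap between consecutive squares.

If `n = 2k + 1`, a close square `x ^ 2` would make `x / 3 ^ k` too good an approximation to `√3`.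
Since `3 ^ 15 + 37 = 3788 ^ 2`, Padé approximants to `√(1 + d/A)` at `A = 3 ^ 15`, `d = 37` give
integers `P`, `Q` for which a combination of `√3 * P` and `Q` is very small
(`abs_padeNum_sub_padeDen_le`), with `Q` of controlled size (`abs_padeDen_mul_le`). Scaling it and
replacing `√3 * 3 ^ k` by `x` gives an integer `Λ` with `|Λ| ≤ 2/3`. But `Λ ≠ 0`, because `P` is
divisible by too few powers of 2 (`not_two_pow_dvd_padeNum`). -/

/-! ### Binomial coefficients with half-integer upper entry -/

/-- The integer `4 ^ m * (b + 1/2).choose m`. -/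
def halfChoose : ℕ → ℕ → ℤ
  | 0, 0 => 1
  | 0, m + 1 => (-1) ^ m * 2 * catalan m
  | _ + 1, 0 => 1
  | b + 1, m + 1 => halfChoose b (m + 1) + 4 * halfChoose b m

theorem halfChoose_zero_right (b : ℕ) : halfChoose b 0 = 1 := by
  cases b <;> simp [halfChoose]

theorem catalan_succ_recurrence (k : ℕ) :
    (k + 2) * catalan (k + 1) = 2 * (2 * k + 1) * catalan k := by
  have h1 := succ_mul_catalan_eq_centralBinom (k + 1)
  have h2 := succ_mul_catalan_eq_centralBinom k
  have h3 := Nat.succ_mul_centralBinom_succ k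
  rw [← h1, ← h2] at h3
  have h4 : (k + 1) * ((k + 2) * catalan (k + 1))
      = (k + 1) * (2 * (2 * k + 1) * catalan k) := by
    linarith
  exact Nat.eq_of_mul_eq_mul_left (Nat.succ_pos k) h4

/-- Pascal's rule in the definition gives integrality; this is the factor-by-factor form, with `4 *
(b + 1/2 - m) = 2 * (2 * b + 1 - 2 * m)`. -/
theorem succ_mul_halfChoose_succ (b m : ℕ) :
    ((m : ℤ) + 1) * halfChoose b (m + 1) = 2 * (2 * b + 1 - 2 * m) * halfChoose b m := by
  induction b generalizing m with
  | zero =>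
    cases m with
    | zero => simp [halfChoose]
    | succ k =>
      have h : ((k : ℤ) + 2) * catalan (k + 1) = 2 * (2 * k + 1) * catalan k := by
        exact_mod_cast catalan_succ_recurrence k
      simp only [halfChoose]
      push_cast
      rw [pow_succ]
      linear_combination (-2 * (-1) ^ k) * h
  | succ b ih =>
    cases m with
    | zero =>
      have := ih 0
      simp only [halfChoose, halfChoose_zero_right] at this ⊢
      push_cast at this ⊢
      linarith
    | succ k =>
      have h1 := ih k
      have h2 := ih (k + 1)
      simp only [halfChoose] at h1 h2 ⊢
      push_cast at h1 h2 ⊢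
      linear_combination h2 + 4 * h1

/-- For `i ≤ b` each factor `b + 1/2 - i` lies between `0` and `b + 1 - i`. -/
theorem halfChoose_bounds (b m : ℕ) (hm : m ≤ b + 1) :
    0 ≤ halfChoose b m ∧ halfChoose b m ≤ 4 ^ m * (b + 1).choose m := by
  induction m with
  | zero => simp [halfChoose_zero_right]
  | succ m ih =>
    obtain ⟨h0, h1⟩ := ih (by omega)
    have hr := succ_mul_halfChoose_succ b m
    have hm' : (m : ℤ) ≤ b := by omega
    have hc : ((b + 1).choose (m + 1) : ℤ) * (m + 1) = (b + 1).choose m * ((b : ℤ) + 1 - m) := by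
      have := Nat.choose_succ_right_eq (b + 1) m
      zify [show m ≤ b + 1 by omega] at this
      exact this
    have hpos : (0 : ℤ) < (m : ℤ) + 1 := by positivity
    constructor
    · refine nonneg_of_mul_nonneg_right (a := (m : ℤ) + 1) ?_ hpos
      rw [hr]
      exact mul_nonneg (by linarith) h0
    · refine le_of_mul_le_mul_left (a := (m : ℤ) + 1) ?_ hpos
      calc ((m : ℤ) + 1) * halfChoose b (m + 1)
          = 2 * (2 * b + 1 - 2 * m) * halfChoose b m := hr
        _ ≤ 4 * (b + 1 - m) * halfChoose b m :=
            mul_le_mul_of_nonneg_right (by linarith) h0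
        _ ≤ 4 * (b + 1 - m) * (4 ^ m * (b + 1).choose m) :=
            mul_le_mul_of_nonneg_left h1 (by linarith)
        _ = ((m : ℤ) + 1) * (4 ^ (m + 1) * (b + 1).choose (m + 1)) := by
            rw [pow_succ]; linear_combination (-4 * 4 ^ m) * hc

/-- The odd part is the product of the numbers `2 * b + 1 - 2 * i` for `i < m`. -/
theorem factorial_mul_halfChoose (b m : ℕ) :
    ∃ e : ℤ, Odd e ∧ (m.factorial : ℤ) * halfChoose b m = 2 ^ m * e := by
  induction m with
  | zero => exact ⟨1, odd_one, by simp [halfChoose_zero_right]⟩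
  | succ m ih =>
    obtain ⟨e, he, h⟩ := ih
    refine ⟨(2 * (b - m) + 1) * e, (odd_two_mul_add_one _).mul he, ?_⟩
    have hr := succ_mul_halfChoose_succ b m
    rw [Nat.factorial_succ, pow_succ]
    push_cast
    linear_combination (m.factorial : ℤ) * hr + 2 * (2 * b + 1 - 2 * m) * h

/-- The `r`-th derivative of `v ^ (b + 1/2)` is `halfDescFactorial b r * v ^ (b + 1/2 - r)`. -/
noncomputable def halfDescFactorial (b r : ℕ) : ℝ := r.factorial * halfChoose b r / 4 ^ r

theorem halfDescFactorial_succ (b r : ℕ) :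
    halfDescFactorial b (r + 1) = (b + 1 / 2 - r) * halfDescFactorial b r := by
  have hr : ((r : ℝ) + 1) * halfChoose b (r + 1) = 2 * (2 * b + 1 - 2 * r) * halfChoose b r := by
    exact_mod_cast succ_mul_halfChoose_succ b r
  unfold halfDescFactorial
  rw [Nat.factorial_succ, pow_succ]
  push_cast
  rw [div_eq_iff (by positivity)]
  field_simp
  linear_combination (2 : ℝ) * hr

theorem abs_halfDescFactorial_le_of_le (b r : ℕ) (hr : r ≤ b + 1) :
    |halfDescFactorial b r| * (b + 1 - r).factorial ≤ (b + 1).factorial := by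
  induction r with
  | zero => simp [halfDescFactorial, halfChoose_zero_right]
  | succ r ih =>
    refine le_trans ?_ (ih (by omega))
    have hrb : (r : ℝ) ≤ b := by exact_mod_cast (show r ≤ b by omega)
    rw [halfDescFactorial_succ, abs_mul, show b + 1 - r = (b + 1 - (r + 1)) + 1 by omega,
      Nat.factorial_succ, abs_of_nonneg (show (0 : ℝ) ≤ b + 1 / 2 - r by linarith)]
    have : ((b + 1 - (r + 1) + 1 : ℕ) : ℝ) = b + 1 - r := by
      rw [show b + 1 - (r + 1) + 1 = b + 1 - r by omega, Nat.cast_sub (by omega)]; push_cast; ring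
    rw [Nat.cast_mul, this]
    have hx : (0 : ℝ) ≤ |halfDescFactorial b r| * (b + 1 - (r + 1)).factorial := by positivity
    nlinarith

/-- The first `b + 1` factors contribute at most `(b + 1)!`; the later ones have absolute values
`1/2, 3/2, …`, bounded by `1, 2, …`. -/
theorem abs_halfDescFactorial_le (b l : ℕ) :
    |halfDescFactorial b (b + 1 + l)| ≤ (b + 1).factorial * l.factorial := by
  induction l with
  | zero => simpa using abs_halfDescFactorial_le_of_le b (b + 1) le_rfl
  | succ l ih =>
    rw [← add_assoc, halfDescFactorial_succ, abs_mul, Nat.factorial_succ l]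
    have : |(b : ℝ) + 1 / 2 - (b + 1 + l : ℕ)| ≤ l + 1 := by
      push_cast
      rw [abs_le]
      have : (0 : ℝ) ≤ l := by positivity
      constructor <;> linarith
    calc _ ≤ ((l : ℝ) + 1) * ((b + 1).factorial * l.factorial) := by gcongr
      _ = _ := by push_cast; ring

/-! ### Padé polynomials: 2-adic valuation and size -/

/-- Homogeneous numerator of the Padé approximant to `√(1 + d/A)`. -/
def padeNum (a b : ℕ) (d A : ℤ) : ℤ :=
  ∑ i ∈ Finset.range (a + 1), (b + i).choose b * halfChoose b (a - i) * 4 ^ i * d ^ (a - i) * A ^ i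

/-- Homogeneous denominator of the Padé approximant to `√(1 + d/A)`, where `B = A + d`,
up to a power of `4`. -/
def padeDen (a b : ℕ) (d B : ℤ) : ℤ :=
  ∑ i ∈ Finset.range (b + 1),
    (-1) ^ (b + i) * (a + i).choose a * halfChoose b (b - i) * 4 ^ i * d ^ (b - i) * B ^ i

/-- After multiplication by `a!`, the term `i = 0` is `2 ^ a` times an odd number, while term `i`
carries `2 ^ (a - i) * 4 ^ i = 2 ^ (a + i)`. -/
theorem not_two_pow_dvd_padeNum (a b : ℕ) {d A : ℤ} (hd : Odd d) :
    ¬ (2 : ℤ) ^ (a + 1) ∣ padeNum a b d A := by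
  have key : ∃ e : ℤ, Odd e ∧ (a.factorial : ℤ) * padeNum a b d A = 2 ^ a * e := by
    unfold padeNum
    rw [Finset.sum_range_succ', mul_add]
    have h1 : ∃ t : ℤ, (a.factorial : ℤ) * ∑ i ∈ Finset.range a, (b + (i + 1)).choose b *
        halfChoose b (a - (i + 1)) * 4 ^ (i + 1) * d ^ (a - (i + 1)) * A ^ (i + 1)
          = 2 ^ (a + 1) * t := by
      rw [Finset.mul_sum]
      refine Finset.dvd_sum fun i hi => ?_
      have hi' : i + 1 ≤ a := Finset.mem_range.mp hi
      obtain ⟨e, -, he⟩ := factorial_mul_halfChoose b (a - (i + 1))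
      obtain ⟨u, hu⟩ := Nat.factorial_dvd_factorial (Nat.sub_le a (i + 1))
      have h2 : (2 : ℤ) ^ (a - (i + 1)) * 4 ^ (i + 1) = 2 ^ (a + 1) * 2 ^ i := by
        rw [show (4 : ℤ) = 2 ^ 2 by norm_num, ← pow_mul, ← pow_add, ← pow_add]
        congr 1; omega
      refine ⟨2 ^ i * u * e * (b + (i + 1)).choose b * d ^ (a - (i + 1)) * A ^ (i + 1), ?_⟩
      rw [hu]
      push_cast
      linear_combination (u * ((b + (i + 1)).choose b : ℤ) * 4 ^ (i + 1) * d ^ (a - (i + 1))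
        * A ^ (i + 1)) * he + (u * e * ((b + (i + 1)).choose b : ℤ) * d ^ (a - (i + 1))
        * A ^ (i + 1)) * h2
    obtain ⟨t, ht⟩ := h1
    obtain ⟨e, he, h⟩ := factorial_mul_halfChoose b a
    refine ⟨2 * t + e * d ^ a, (even_two_mul t).add_odd (he.mul hd.pow), ?_⟩
    rw [ht, pow_succ]
    simp only [add_zero, Nat.choose_self, Nat.sub_zero, pow_zero, Nat.cast_one, mul_one, one_mul]
    linear_combination d ^ a * h
  rintro ⟨t, ht⟩
  obtain ⟨e, he, h⟩ := key
  rw [ht, pow_succ] at h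
  have h2 : e = 2 * (a.factorial * t) := by
    have : (2 : ℤ) ^ a ≠ 0 := by positivity
    exact mul_left_cancel₀ this (by linear_combination -h)
  exact (Int.not_even_iff_odd.mpr he) (h2 ▸ even_two_mul _)

/-- After bounding each coefficient, `B` times the remaining sum is the expansion of `(B + d) ^ (b +
1)` without its `B ^ 0` term. -/
theorem abs_padeDen_mul_le (a b : ℕ) {d B : ℤ} (hd : 0 ≤ d) (hB : 0 ≤ B) :
    |padeDen a b d B| * B ≤ 4 ^ b * (a + b).choose a * (B + d) ^ (b + 1) := by
  have h1 : |padeDen a b d B| ≤ ∑ i ∈ Finset.range (b + 1),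
      4 ^ b * (a + b).choose a * (B ^ i * d ^ (b - i) * (b + 1).choose (i + 1)) := by
    refine (Finset.abs_sum_le_sum_abs _ _).trans (Finset.sum_le_sum fun i hi => ?_)
    have hi' : i ≤ b := Nat.lt_succ_iff.mp (Finset.mem_range.mp hi)
    obtain ⟨h0, h1⟩ := halfChoose_bounds b (b - i) (by omega)
    have hc : ((a + i).choose a : ℤ) ≤ (a + b).choose a := by
      exact_mod_cast Nat.choose_le_choose a (by omega)
    rw [show (b + 1).choose (b - i) = (b + 1).choose (i + 1) by
      rw [← Nat.choose_symm (show i + 1 ≤ b + 1 by omega)]; congr 1; omega] at h1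
    rw [abs_mul, abs_mul, abs_mul, abs_mul, abs_mul, abs_pow, abs_neg, abs_one, one_pow, one_mul,
      abs_of_nonneg h0, abs_of_nonneg (pow_nonneg hd _), abs_of_nonneg (pow_nonneg hB _), Nat.abs_cast,
      abs_of_nonneg (show (0 : ℤ) ≤ 4 ^ i by positivity)]
    calc _ ≤ ((a + b).choose a : ℤ) * (4 ^ (b - i) * (b + 1).choose (i + 1)) * 4 ^ i
          * d ^ (b - i) * B ^ i := by gcongr
      _ = (4 ^ (b - i) * 4 ^ i) * (a + b).choose a
          * (B ^ i * d ^ (b - i) * (b + 1).choose (i + 1)) := by ring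
      _ = _ := by rw [← pow_add, Nat.sub_add_cancel hi']
  have h2 : (∑ i ∈ Finset.range (b + 1), B ^ i * d ^ (b - i) * ((b + 1).choose (i + 1) : ℤ)) * B
      ≤ (B + d) ^ (b + 1) := by
    rw [add_pow, Finset.sum_range_succ' _ (b + 1), Finset.sum_mul]
    refine le_add_of_le_of_nonneg (Finset.sum_le_sum fun i _ => le_of_eq ?_) (by positivity)
    rw [Nat.add_sub_add_right, pow_succ]
    ring
  rw [← Finset.mul_sum] at h1
  calc _ ≤ _ := mul_le_mul_of_nonneg_right h1 hB
    _ = 4 ^ b * (a + b).choose a * ((∑ i ∈ Finset.range (b + 1),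
          B ^ i * d ^ (b - i) * ((b + 1).choose (i + 1) : ℤ)) * B) := by ring
    _ ≤ _ := by gcongr

/-! ### Padé remainder through repeated integration by parts -/

open Polynomial in
/-- `∑ (-1) ^ m * g⁽ᵐ⁾ * h⁽ᴺ⁻¹⁻ᵐ⁾` for `h v = v ^ (b + 1/2)`: an antiderivative of `g * h⁽ᴺ⁾` when
`deg g < N`. -/
noncomputable def altDerivSum (g : ℝ[X]) (b N : ℕ) (v : ℝ) : ℝ :=
  ∑ m ∈ Finset.range N, (-1) ^ m * (derivative^[m] g).eval v *
    (halfDescFactorial b (N - 1 - m) * v ^ ((b : ℝ) + 1 / 2 - (N - 1 - m : ℕ)))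

open Polynomial in
-- The derivative telescopes; the far end vanishes because the `N`-th derivative of `g` is zero.
theorem hasDerivAt_altDerivSum (g : ℝ[X]) (b : ℕ) {N : ℕ} (hN : g.natDegree < N) {v : ℝ}
    (hv : 0 < v) :
    HasDerivAt (altDerivSum g b N)
      (g.eval v * (halfDescFactorial b N * v ^ ((b : ℝ) + 1 / 2 - N))) v := by
  set T : ℕ → ℝ := fun m => (-1) ^ m * (derivative^[m] g).eval v *
    (halfDescFactorial b (N - m) * v ^ ((b : ℝ) + 1 / 2 - (N - m : ℕ))) with hT
  have hterm : ∀ m ∈ Finset.range N, HasDerivAt (fun v : ℝ =>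
      (-1) ^ m * (derivative^[m] g).eval v *
        (halfDescFactorial b (N - 1 - m) * v ^ ((b : ℝ) + 1 / 2 - (N - 1 - m : ℕ))))
      (T m - T (m + 1)) v := by
    intro m hm
    have hm' : m < N := Finset.mem_range.mp hm
    have h1 := ((derivative^[m] g).hasDerivAt v).const_mul ((-1 : ℝ) ^ m)
    have h2 := (Real.hasDerivAt_rpow_const (x := v) (p := (b : ℝ) + 1 / 2 - (N - 1 - m : ℕ))
      (Or.inl hv.ne')).const_mul (halfDescFactorial b (N - 1 - m))
    refine (h1.mul h2).congr_deriv ?_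
    have e1 : N - m = (N - 1 - m) + 1 := by omega
    have e2 : N - (m + 1) = N - 1 - m := by omega
    simp only [hT]
    rw [e2, e1, halfDescFactorial_succ, Function.iterate_succ_apply', pow_succ]
    push_cast
    rw [show (b : ℝ) + 1 / 2 - ((N - 1 - m : ℕ) + 1) = b + 1 / 2 - (N - 1 - m : ℕ) - 1 by ring]
    ring
  have hsum := HasDerivAt.fun_sum hterm
  refine hsum.congr_deriv ?_
  rw [Finset.sum_range_sub']
  simp only [hT]
  rw [Polynomial.iterate_derivative_eq_zero hN]
  simp

open Polynomial in
theorem eval_iterate_derivative_eq_factorial_mul (g : ℝ[X]) (m : ℕ) (r : ℝ) :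
    (derivative^[m] g).eval r = m.factorial * (taylor r g).coeff m := by
  rw [taylor_coeff, ← factorial_smul_hasseDeriv]
  simp

open Polynomial in
/-- The polynomial `(A + d - X) ^ a * (X - A) ^ b`. -/
noncomputable def endpointPoly (a b : ℕ) (d A : ℝ) : ℝ[X] :=
  (C (A + d) - X) ^ a * (X - C A) ^ b

open Polynomial in
theorem natDegree_endpointPoly_le (a b : ℕ) (d A : ℝ) :
    (endpointPoly a b d A).natDegree ≤ a + b := by
  unfold endpointPoly
  refine natDegree_mul_le.trans (add_le_add ?_ ?_)
  · refine natDegree_pow_le.trans ?_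
    have : (C (A + d) - X : ℝ[X]).natDegree ≤ 1 := by
      refine (natDegree_sub_le _ _).trans ?_
      simp
    nlinarith
  · refine natDegree_pow_le.trans ?_
    simp

open Polynomial in
theorem taylor_left_endpointPoly_coeff (a b m : ℕ) (d A : ℝ) :
    (taylor A (endpointPoly a b d A)).coeff m =
      if b ≤ m then (-1) ^ (m - b) * d ^ (a - (m - b)) * a.choose (m - b) else 0 := by
  have h : taylor A (endpointPoly a b d A) = (C ((-1) ^ a) * (X - C d) ^ a) * X ^ b := by
    unfold endpointPoly
    rw [taylor_mul, taylor_pow, taylor_pow, map_sub, map_sub, taylor_C, taylor_C, taylor_X,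
      map_pow, map_neg, map_one, ← mul_pow]
    congr 2
    · rw [map_add]; ring
    · ring
  rw [h, coeff_mul_X_pow']
  split_ifs with hm
  · rw [coeff_C_mul, sub_eq_add_neg, ← C_neg, coeff_X_add_C_pow]
    rcases le_or_gt (m - b) a with hle | hlt
    · obtain ⟨t, ht⟩ := Nat.exists_eq_add_of_le hle
      rw [show a - (m - b) = t by omega, ht, neg_pow d, pow_add]
      have : ((-1 : ℝ) ^ t) * (-1) ^ t = 1 := by rw [← mul_pow]; simp
      linear_combination ((-1 : ℝ) ^ (m - b) * d ^ t * ((m - b + t).choose (m - b) : ℝ)) * this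
    · simp [Nat.choose_eq_zero_of_lt hlt]
  · rfl

open Polynomial in
theorem taylor_right_endpointPoly_coeff (a b m : ℕ) (d A : ℝ) :
    (taylor (A + d) (endpointPoly a b d A)).coeff m =
      if a ≤ m then (-1) ^ a * d ^ (b - (m - a)) * b.choose (m - a) else 0 := by
  have h : taylor (A + d) (endpointPoly a b d A) = (C ((-1) ^ a) * (X + C d) ^ b) * X ^ a := by
    unfold endpointPoly
    rw [taylor_mul, taylor_pow, taylor_pow, map_sub, map_sub, taylor_C, taylor_C, taylor_X,
      map_pow, map_neg, map_one, mul_right_comm, ← mul_pow]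
    congr 2
    · ring
    · rw [map_add]; ring
  rw [h, coeff_mul_X_pow']
  split_ifs with hm
  · rw [coeff_C_mul, coeff_X_add_C_pow]; ring
  · rfl

/-- `endpointPoly` vanishes to order `b` at `A`, so only derivatives of order at least `b` survive,
and they assemble into `padeNum`. The right endpoint gives `padeDen` in the same way. -/
theorem altDerivSum_left (a b : ℕ) (d A : ℤ) (hA : 0 < A) (hab : b ≤ a) :
    altDerivSum (endpointPoly a b d A) b (a + b + 1) A * A ^ (a - b) * 4 ^ a =
      (-1) ^ b * a.factorial * b.factorial * √(A : ℝ) * padeNum a b d A := by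
  have hA' : (0 : ℝ) < A := by exact_mod_cast hA
  unfold altDerivSum
  rw [show a + b + 1 = b + (a + 1) by ring, Finset.sum_range_add, Finset.sum_eq_zero, zero_add,
    padeNum]
  · push_cast
    rw [Finset.mul_sum, Finset.sum_mul, Finset.sum_mul]
    refine Finset.sum_congr rfl fun i hi => ?_
    have hi' : i ≤ a := Nat.lt_succ_iff.mp (Finset.mem_range.mp hi)
    rw [eval_iterate_derivative_eq_factorial_mul, taylor_left_endpointPoly_coeff,
      if_pos (Nat.le_add_right b i), Nat.add_sub_cancel_left,
      show b + (a + 1) - 1 - (b + i) = a - i by omega, halfDescFactorial]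
    have e1 : (A : ℝ) ^ ((b : ℝ) + 1 / 2 - (a - i : ℕ)) * A ^ (a - b) = √(A : ℝ) * A ^ i := by
      rw [Real.sqrt_eq_rpow, ← Real.rpow_natCast, ← Real.rpow_natCast, ← Real.rpow_add hA',
        ← Real.rpow_add hA']
      congr 1
      rw [Nat.cast_sub hi', Nat.cast_sub hab]
      ring
    have e2 : ((b + i).factorial : ℝ) * (a - i).factorial * a.choose i
        = a.factorial * b.factorial * (b + i).choose b := by
      have h1 : ((b + i).choose b * b.factorial * i.factorial : ℝ) = (b + i).factorial := by
        exact_mod_cast (by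
          have := Nat.choose_mul_factorial_mul_factorial (Nat.le_add_right b i)
          rwa [Nat.add_sub_cancel_left] at this)
      have h2 : (a.choose i * i.factorial * (a - i).factorial : ℝ) = a.factorial := by
        exact_mod_cast Nat.choose_mul_factorial_mul_factorial hi'
      rw [← h1, ← h2]
      ring
    have e3 : (4 : ℝ) ^ a = 4 ^ (a - i) * 4 ^ i := by rw [← pow_add, Nat.sub_add_cancel hi']
    have e4 : (-1 : ℝ) ^ (b + i) * (-1) ^ i = (-1) ^ b := by
      rw [pow_add, mul_assoc, ← mul_pow]; simp
    calc _ = ((-1 : ℝ) ^ (b + i) * (-1) ^ i) * d ^ (a - i) *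
          (((b + i).factorial : ℝ) * (a - i).factorial * a.choose i)
          * (halfChoose b (a - i) / 4 ^ (a - i)) *
          ((A : ℝ) ^ ((b : ℝ) + 1 / 2 - (a - i : ℕ)) * A ^ (a - b)) * 4 ^ a := by ring
      _ = _ := by
        rw [e1, e2, e3, e4]
        field_simp
  · intro m hm
    rw [eval_iterate_derivative_eq_factorial_mul, taylor_left_endpointPoly_coeff,
      if_neg (by simpa using hm)]
    ring

theorem altDerivSum_right (a b : ℕ) (d A : ℤ) (hB : 0 < A + d) :
    altDerivSum (endpointPoly a b d A) b (a + b + 1) (A + d) * 4 ^ b =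
      (-1) ^ b * a.factorial * b.factorial * √(A + d : ℝ) * padeDen a b d (A + d) := by
  have hB' : (0 : ℝ) < A + d := by exact_mod_cast hB
  unfold altDerivSum
  rw [show a + b + 1 = a + (b + 1) by ring, Finset.sum_range_add, Finset.sum_eq_zero, zero_add,
    padeDen]
  · push_cast
    rw [Finset.mul_sum, Finset.sum_mul]
    refine Finset.sum_congr rfl fun i hi => ?_
    have hi' : i ≤ b := Nat.lt_succ_iff.mp (Finset.mem_range.mp hi)
    rw [eval_iterate_derivative_eq_factorial_mul, taylor_right_endpointPoly_coeff,
      if_pos (Nat.le_add_right a i), Nat.add_sub_cancel_left,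
      show a + (b + 1) - 1 - (a + i) = b - i by omega, halfDescFactorial]
    have e1 : (A + d : ℝ) ^ ((b : ℝ) + 1 / 2 - (b - i : ℕ)) = √(A + d : ℝ) * (A + d) ^ i := by
      rw [Real.sqrt_eq_rpow, ← Real.rpow_natCast, ← Real.rpow_add hB']
      congr 1
      rw [Nat.cast_sub hi']
      ring
    have e2 : ((a + i).factorial : ℝ) * (b - i).factorial * b.choose i
        = a.factorial * b.factorial * (a + i).choose a := by
      have h1 : ((a + i).choose a * a.factorial * i.factorial : ℝ) = (a + i).factorial := by
        exact_mod_cast (by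
          have := Nat.choose_mul_factorial_mul_factorial (Nat.le_add_right a i)
          rwa [Nat.add_sub_cancel_left] at this)
      have h2 : (b.choose i * i.factorial * (b - i).factorial : ℝ) = b.factorial := by
        exact_mod_cast Nat.choose_mul_factorial_mul_factorial hi'
      rw [← h1, ← h2]
      ring
    have e3 : (4 : ℝ) ^ b = 4 ^ (b - i) * 4 ^ i := by rw [← pow_add, Nat.sub_add_cancel hi']
    have e4 : (-1 : ℝ) ^ (a + i) * (-1) ^ a = (-1) ^ b * (-1) ^ (b + i) := by
      rw [pow_add, pow_add, ← mul_assoc, ← mul_pow, mul_right_comm, ← mul_pow]; simp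
    calc _ = ((-1 : ℝ) ^ (a + i) * (-1) ^ a) * d ^ (b - i) *
          (((a + i).factorial : ℝ) * (b - i).factorial * b.choose i)
          * (halfChoose b (b - i) / 4 ^ (b - i)) *
          ((A + d : ℝ) ^ ((b : ℝ) + 1 / 2 - (b - i : ℕ))) * 4 ^ b := by ring
      _ = _ := by
        rw [e1, e2, e3, e4]
        field_simp
  · intro m hm
    rw [eval_iterate_derivative_eq_factorial_mul, taylor_right_endpointPoly_coeff,
      if_neg (by simpa using hm)]
    ring

theorem abs_eval_endpointPoly_le (a b : ℕ) {d A κ : ℝ} (hd : 0 < d)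
    (hκ : ∀ u ∈ Set.Icc (0 : ℝ) 1, (1 - u) ^ a * u ^ b ≤ κ) {v : ℝ} (hv : v ∈ Set.Icc A (A + d)) :
    |(endpointPoly a b d A).eval v| ≤ d ^ (a + b) * κ := by
  obtain ⟨h1, h2⟩ := hv
  have hu : (v - A) / d ∈ Set.Icc (0 : ℝ) 1 :=
    ⟨div_nonneg (by linarith) hd.le, (div_le_one hd).mpr (by linarith)⟩
  have he : (endpointPoly a b d A).eval v
      = d ^ (a + b) * ((1 - (v - A) / d) ^ a * ((v - A) / d) ^ b) := by
    simp only [endpointPoly, Polynomial.eval_mul, Polynomial.eval_pow, Polynomial.eval_sub,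
      Polynomial.eval_C, Polynomial.eval_X]
    rw [pow_add, mul_mul_mul_comm, ← mul_pow, ← mul_pow, mul_sub, mul_div_cancel₀ _ hd.ne']
    congr 2
    ring
  have h0 : 0 ≤ (1 - (v - A) / d) ^ a * ((v - A) / d) ^ b :=
    mul_nonneg (pow_nonneg (by linarith [hu.2]) _) (pow_nonneg hu.1 _)
  rw [he, abs_of_nonneg (mul_nonneg (by positivity) h0)]
  exact mul_le_mul_of_nonneg_left (hκ _ hu) (by positivity)

/-- Mean value inequality: the derivative is `endpointPoly` times a multiple of `v ^ (-(a + 1/2))`,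
and that power is largest at `v = A`. -/
theorem abs_altDerivSum_sub_le (a b : ℕ) {d A κ : ℝ} (hd : 0 < d) (hA : 0 < A)
    (hκ : ∀ u ∈ Set.Icc (0 : ℝ) 1, (1 - u) ^ a * u ^ b ≤ κ) :
    |altDerivSum (endpointPoly a b d A) b (a + b + 1) (A + d)
        - altDerivSum (endpointPoly a b d A) b (a + b + 1) A| * A ^ a * √A
      ≤ (b + 1) * a.factorial * b.factorial * d ^ (a + b + 1) * κ := by
  have hκ0 : 0 ≤ κ := le_trans (by norm_num) (hκ (1 / 2) (by norm_num))
  have hsq : 0 < √A := Real.sqrt_pos.mpr hA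
  have hbound : ∀ v ∈ Set.Icc A (A + d), ‖(endpointPoly a b d A).eval v *
      (halfDescFactorial b (a + b + 1) * v ^ ((b : ℝ) + 1 / 2 - (a + b + 1 : ℕ)))‖
      ≤ (d ^ (a + b) * κ) * (((b + 1).factorial * a.factorial) * (A ^ a * √A)⁻¹) := by
    intro v hv
    have hv0 : 0 < v := hA.trans_le hv.1
    rw [norm_mul, norm_mul, Real.norm_eq_abs, Real.norm_eq_abs, Real.norm_eq_abs]
    have h1 := abs_eval_endpointPoly_le a b hd hκ hv
    have h2 := abs_halfDescFactorial_le b a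
    rw [show b + 1 + a = a + b + 1 by ring] at h2
    have h3 : |v ^ ((b : ℝ) + 1 / 2 - (a + b + 1 : ℕ))| ≤ (A ^ a * √A)⁻¹ := by
      rw [abs_of_nonneg (by positivity), Real.sqrt_eq_rpow, ← Real.rpow_natCast,
        ← Real.rpow_add hA, ← Real.rpow_neg hA.le,
        show (b : ℝ) + 1 / 2 - (a + b + 1 : ℕ) = -(a + 1 / 2) by push_cast; ring]
      exact Real.rpow_le_rpow_of_nonpos hA hv.1 (by
        have : (0 : ℝ) ≤ a := by positivity
        linarith)
    gcongr
  have hmvt := (convex_Icc A (A + d)).norm_image_sub_le_of_norm_hasDerivWithin_le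
    (fun v hv => (hasDerivAt_altDerivSum (endpointPoly a b d A) b
      (Nat.lt_succ_of_le (natDegree_endpointPoly_le a b d A))
      (hA.trans_le hv.1)).hasDerivWithinAt) hbound
    (Set.left_mem_Icc.mpr (by linarith)) (Set.right_mem_Icc.mpr (by linarith))
  rw [Real.norm_eq_abs, Real.norm_eq_abs, add_sub_cancel_left, abs_of_pos hd] at hmvt
  rw [mul_assoc]
  calc _ ≤ (d ^ (a + b) * κ) * (((b + 1).factorial * a.factorial) * (A ^ a * √A)⁻¹) * d
        * (A ^ a * √A) := by gcongr
    _ = _ := by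
      rw [Nat.factorial_succ, pow_succ]
      push_cast
      field_simp

/-- Quality of the Padé approximation to `√((A + d) / A)`. -/
theorem abs_padeNum_sub_padeDen_le (a b : ℕ) (d A : ℤ) (hd : 0 < d) (hA : 0 < A) (hab : b ≤ a)
    {κ : ℝ} (hκ : ∀ u ∈ Set.Icc (0 : ℝ) 1, (1 - u) ^ a * u ^ b ≤ κ) :
    |√(A : ℝ) * padeNum a b d A - A ^ (a - b) * √(A + d : ℝ) * 4 ^ (a - b) * padeDen a b d (A + d)|
        * A ^ b * √(A : ℝ) ≤ 4 ^ a * (b + 1) * d ^ (a + b + 1) * κ := by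
  have hA' : (0 : ℝ) < A := by exact_mod_cast hA
  have hd' : (0 : ℝ) < d := by exact_mod_cast hd
  have hl := altDerivSum_left a b d A hA hab
  have hr := altDerivSum_right a b d A (by omega)
  have hm := abs_altDerivSum_sub_le a b hd' hA' hκ
  set L := altDerivSum (endpointPoly a b d A) b (a + b + 1) A
  set R := altDerivSum (endpointPoly a b d A) b (a + b + 1) (A + d)
  have h4 : (4 : ℝ) ^ a = 4 ^ (a - b) * 4 ^ b := by rw [← pow_add, Nat.sub_add_cancel hab]
  have hAa : (A : ℝ) ^ a = A ^ (a - b) * A ^ b := by rw [← pow_add, Nat.sub_add_cancel hab]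
  set W : ℝ := √(A : ℝ) * padeNum a b d A
    - A ^ (a - b) * √(A + d : ℝ) * 4 ^ (a - b) * padeDen a b d (A + d)
  have hW : (-1) ^ b * (a.factorial * b.factorial) * W = -((R - L) * A ^ (a - b) * 4 ^ a) := by
    simp only [W]
    rw [h4] at hl ⊢
    linear_combination -hl + (A : ℝ) ^ (a - b) * 4 ^ (a - b) * hr
  have hW' : (a.factorial * b.factorial : ℝ) * |W| = |R - L| * A ^ (a - b) * 4 ^ a := by
    have := congrArg abs hW
    simpa only [abs_mul, abs_neg, abs_pow, abs_one, one_pow, one_mul, Nat.abs_cast,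
      abs_of_pos hA', Nat.abs_ofNat] using this
  refine le_of_mul_le_mul_left (a := (a.factorial * b.factorial : ℝ)) ?_ (by positivity)
  calc _ = ((a.factorial * b.factorial : ℝ) * |W|) * A ^ b * √(A : ℝ) := by ring
    _ = 4 ^ a * (|R - L| * A ^ a * √(A : ℝ)) := by rw [hW', hAa]; ring
    _ ≤ 4 ^ a * ((b + 1) * a.factorial * b.factorial * d ^ (a + b + 1) * κ) := by gcongr
    _ = _ := by ring

/-! ### Numerical estimates for degrees `7j` and `3j` -/

/-- Weighted AM-GM, with equality at `u = 3/10`. -/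
theorem one_sub_pow_seven_mul_pow_three_le {u : ℝ} (hu : u ∈ Set.Icc (0 : ℝ) 1) :
    (1 - u) ^ 7 * u ^ 3 ≤ 7 ^ 7 * 3 ^ 3 / 10 ^ 10 := by
  obtain ⟨h0, h1⟩ := hu
  have hp : (0 : ℝ) ≤ (1 - u) * (10 / 7) := by linarith
  have hq : (0 : ℝ) ≤ u * (10 / 3) := by linarith
  have h := Real.geom_mean_le_arith_mean2_weighted (w₁ := 7 / 10) (w₂ := 3 / 10)
    (by norm_num) (by norm_num) hp hq (by norm_num)
  rw [show (7 / 10 : ℝ) * ((1 - u) * (10 / 7)) + 3 / 10 * (u * (10 / 3)) = 1 by ring] at h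
  have h10 := pow_le_pow_left₀ (by positivity) h 10
  rw [one_pow, mul_pow, ← Real.rpow_natCast, ← Real.rpow_natCast, ← Real.rpow_mul hp,
    ← Real.rpow_mul hq, show (7 / 10 : ℝ) * (10 : ℕ) = (7 : ℕ) by norm_num,
    show (3 / 10 : ℝ) * (10 : ℕ) = (3 : ℕ) by norm_num, Real.rpow_natCast, Real.rpow_natCast,
    mul_pow, mul_pow] at h10
  nlinarith

/-- The binomial coefficient appears in a single term of `(7 + 3) ^ (10 * j)`. -/
theorem choose_ten_mul_le (j : ℕ) :
    ((10 * j).choose (7 * j) : ℝ) ≤ (10 ^ 10 / (7 ^ 7 * 3 ^ 3)) ^ j := by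
  have h := Finset.single_le_sum (f := fun m => (7 : ℝ) ^ m * 3 ^ (10 * j - m) * (10 * j).choose m)
    (fun i _ => by positivity) (Finset.mem_range.mpr (show 7 * j < 10 * j + 1 by omega))
  rw [← add_pow, show 10 * j - 7 * j = 3 * j by omega, pow_mul, pow_mul, pow_mul, ← mul_pow] at h
  rw [div_pow, le_div_iff₀ (by positivity), mul_comm]
  norm_num at h ⊢
  exact h

theorem three_mul_add_one_le_two_pow {j : ℕ} (hj : 11 ≤ j) : 3 * j + 1 ≤ 2 ^ j := by
  induction j, hj using Nat.le_induction with
  | base => norm_num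
  | succ j hj ih => rw [pow_succ]; omega

/-- The base `19/10` is nearly forced: `main_term_le` leaves only a factor of about `1.947` per step
in `j` to absorb the cubic growth. -/
theorem cube_le_two_mul_pow {j : ℕ} (hj : 11 ≤ j) : (j : ℝ) ^ 3 ≤ 2 * (19 / 10) ^ j := by
  induction j, hj using Nat.le_induction with
  | base => norm_num
  | succ j hj ih =>
    have hj' : (11 : ℝ) ≤ j := by exact_mod_cast hj
    rw [pow_succ (19 / 10 : ℝ)]
    push_cast
    nlinarith [mul_nonneg (sq_nonneg (j : ℝ)) (sub_nonneg.mpr hj'),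
      mul_nonneg (show (0 : ℝ) ≤ j by linarith) (sub_nonneg.mpr hj')]

/-- Each step in `j` gains a factor `8000`; eleven steps pay for `3 ^ r ≤ 3 ^ 89`, hence `11 ≤ j`.
-/
theorem remainder_term_le {j r : ℕ} (hj : 11 ≤ j) (hr : r ≤ 89) :
    (3 : ℝ) ^ r * (4 ^ (7 * j) * (3 * j + 1) * 37 ^ (10 * j + 1) * (7 ^ 7 * 3 ^ 3 / 10 ^ 10) ^ j)
      ≤ 1 / 3 * (3 ^ (45 * j) * 3 ^ 7) := by
  have h1 : (3 : ℝ) * j + 1 ≤ 2 ^ j := by exact_mod_cast three_mul_add_one_le_two_pow hj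
  have h2 : (3 : ℝ) ^ r ≤ 3 ^ 89 := pow_le_pow_right₀ (by norm_num) hr
  have h3 : ((4 : ℝ) ^ 7 * 2 * 37 ^ 10 * (7 ^ 7 * 3 ^ 3 / 10 ^ 10)) ≤ 3 ^ 45 / 8000 := by norm_num
  calc _ ≤ (3 : ℝ) ^ 89 * (4 ^ (7 * j) * 2 ^ j * 37 ^ (10 * j + 1)
        * (7 ^ 7 * 3 ^ 3 / 10 ^ 10) ^ j) := by gcongr
    _ = 3 ^ 89 * 37 * ((4 : ℝ) ^ 7 * 2 * 37 ^ 10 * (7 ^ 7 * 3 ^ 3 / 10 ^ 10)) ^ j := by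
        rw [mul_pow, mul_pow, mul_pow, pow_mul, pow_succ (37 : ℝ) (10 * j), pow_mul]; ring
    _ ≤ 3 ^ 89 * 37 * (3 ^ 45 / 8000 : ℝ) ^ j := by gcongr
    _ = 3 ^ 89 * 37 * (1 / 8000 : ℝ) ^ j * 3 ^ (45 * j) := by
        rw [div_eq_mul_one_div, mul_pow, pow_mul]; ring
    _ ≤ 3 ^ 89 * 37 * (1 / 8000 : ℝ) ^ 11 * 3 ^ (45 * j) := by
        gcongr ?_ * ?_ * ?_ * ?_
        exact pow_le_pow_of_le_one (by norm_num) (by norm_num) hj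
    _ ≤ (1 / 3 * 3 ^ 7) * 3 ^ (45 * j) :=
        mul_le_mul_of_nonneg_right (by norm_num) (by positivity)
    _ = _ := by ring

theorem main_term_le {j k : ℕ} (hj : 11 ≤ j) (hk : 60 * j + 30 ≤ k) (hk' : k ≤ 60 * j + 89)
    {q : ℝ} (hq : q * (3 ^ 15 + 37) ≤
      4 ^ (3 * j) * (10 * j).choose (7 * j) * (3 ^ 15 + 74) ^ (3 * j + 1)) :
    3788 * 4 ^ (4 * j) * q * ((2 * k + 1) ^ 3 + (2 * k + 1)) ≤ 1 / 3 * 3 ^ k := by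
  have hj' : (11 : ℝ) ≤ j := by exact_mod_cast hj
  -- Here `2k + 1 ≤ 120j + 179`, and `179 ≤ 17j` once `j ≥ 11`.
  have hkj : (2 : ℝ) * k + 1 ≤ 137 * j := by
    have : (k : ℝ) ≤ 60 * j + 89 := by exact_mod_cast hk'
    linarith
  have h0 : (1 : ℝ) ≤ 2 * k + 1 := by
    have : (0 : ℝ) ≤ k := by positivity
    linarith
  have hD : ((2 : ℝ) * k + 1) ^ 3 + (2 * k + 1) ≤ 4 * 137 ^ 3 * (19 / 10) ^ j := by
    have h1 : ((2 : ℝ) * k + 1) ^ 3 ≤ (137 * j) ^ 3 := by gcongr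
    have h2 : (2 : ℝ) * k + 1 ≤ (2 * k + 1) ^ 3 := by nlinarith [sq_nonneg ((2 : ℝ) * k + 1)]
    have h3 := cube_le_two_mul_pow hj
    rw [mul_pow] at h1
    linarith
  have hc := choose_ten_mul_le j
  have hq' : q ≤ 2 * (4 ^ 3 * (10 ^ 10 / (7 ^ 7 * 3 ^ 3)) * (3 ^ 15 + 74) ^ 3) ^ j := by
    refine le_of_mul_le_mul_right (a := (3 ^ 15 + 37 : ℝ)) ?_ (by positivity)
    calc _ ≤ _ := hq
      _ ≤ 4 ^ (3 * j) * (10 ^ 10 / (7 ^ 7 * 3 ^ 3)) ^ j * (3 ^ 15 + 74) ^ (3 * j + 1) := by gcongr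
      _ = (4 ^ 3 * (10 ^ 10 / (7 ^ 7 * 3 ^ 3)) * (3 ^ 15 + 74) ^ 3) ^ j * (3 ^ 15 + 74) := by
          rw [mul_pow, mul_pow, pow_mul, pow_succ (3 ^ 15 + 74 : ℝ) (3 * j), pow_mul]; ring
      _ ≤ (4 ^ 3 * (10 ^ 10 / (7 ^ 7 * 3 ^ 3)) * (3 ^ 15 + 74) ^ 3) ^ j
          * (2 * (3 ^ 15 + 37)) := by
          gcongr
          norm_num
      _ = _ := by ring
  calc _ ≤ 3788 * 4 ^ (4 * j) * (2 * (4 ^ 3 * (10 ^ 10 / (7 ^ 7 * 3 ^ 3)) * (3 ^ 15 + 74) ^ 3) ^ j)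
        * (4 * 137 ^ 3 * (19 / 10 : ℝ) ^ j) := by gcongr
    _ = 3788 * 8 * 137 ^ 3 * (4 ^ 4 * (4 ^ 3 * (10 ^ 10 / (7 ^ 7 * 3 ^ 3)) * (3 ^ 15 + 74) ^ 3)
        * (19 / 10 : ℝ)) ^ j := by
        rw [pow_mul, mul_pow _ (19 / 10 : ℝ), mul_pow (4 ^ 4 : ℝ)]; ring
    _ ≤ 3788 * 8 * 137 ^ 3 * (3 ^ 60 : ℝ) ^ j := by
        gcongr
        norm_num
    _ ≤ (1 / 3 * 3 ^ 30) * (3 ^ 60 : ℝ) ^ j :=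
        mul_le_mul_of_nonneg_right (by norm_num) (by positivity)
    _ = 1 / 3 * 3 ^ (60 * j + 30) := by rw [pow_add, pow_mul]; ring
    _ ≤ 1 / 3 * 3 ^ k := by
        gcongr
        norm_num

/-! ### Distance from large powers of 3 to squares -/

theorem abs_sqrt_three_mul_pow_sub_le {k x : ℕ} {D : ℝ} (h : |(3 : ℝ) * 9 ^ k - x ^ 2| ≤ D) :
    |√3 * 3 ^ k - x| * 3 ^ k ≤ D := by
  refine le_trans ?_ h
  have hs : √(3 : ℝ) ^ 2 = 3 := Real.sq_sqrt (by norm_num)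
  have hs1 : (1 : ℝ) ≤ √3 := Real.one_le_sqrt.mpr (by norm_num)
  have h9 : (9 : ℝ) ^ k = (3 ^ k) ^ 2 := by rw [← pow_mul, mul_comm, pow_mul]; norm_num
  have hfac : (3 : ℝ) * 9 ^ k - x ^ 2 = (√3 * 3 ^ k - x) * (√3 * 3 ^ k + x) := by
    rw [h9]; linear_combination (-((3 : ℝ) ^ k) ^ 2) * hs
  have hx : (0 : ℝ) ≤ x := by positivity
  have h3 : (0 : ℝ) < 3 ^ k := by positivity
  have hge : (3 : ℝ) ^ k ≤ √3 * 3 ^ k + x := by nlinarith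
  rw [hfac, abs_mul, abs_of_pos (h3.trans_le hge)]
  gcongr

/-- Odd powers of `3` are far from squares. -/
theorem lt_abs_three_mul_nine_pow_sub_sq {k : ℕ} (hk : 690 ≤ k) (x : ℕ) :
    ((2 : ℝ) * k + 1) ^ 3 + (2 * k + 1) < |(3 : ℝ) * 9 ^ k - x ^ 2| := by
  by_contra! hcon
  -- The block length `60 = 15 * 4` matches `A ^ (a - b) = (3 ^ 15) ^ (4 * j)`, and `690 = 60 * 11 +
  -- 30` guarantees `j ≥ 11`. Taking `r ≥ 30` gives the main term the slack `3 ^ 30` for its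
  -- constants.
  obtain ⟨j, r, hj, hr, hr', rfl⟩ : ∃ j r : ℕ, 11 ≤ j ∧ 30 ≤ r ∧ r ≤ 89 ∧ k = 60 * j + r :=
    ⟨(k - 30) / 60, 30 + (k - 30) % 60, by omega, by omega, by omega, by omega⟩
  set k := 60 * j + r with hkdef
  have hκ : ∀ u ∈ Set.Icc (0 : ℝ) 1,
      (1 - u) ^ (7 * j) * u ^ (3 * j) ≤ (7 ^ 7 * 3 ^ 3 / 10 ^ 10) ^ j := by
    intro u hu
    rw [pow_mul, pow_mul, ← mul_pow]
    have h0 : 0 ≤ (1 - u) ^ 7 * u ^ 3 :=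
      mul_nonneg (pow_nonneg (by linarith [hu.2]) _) (pow_nonneg hu.1 _)
    exact pow_le_pow_left₀ h0 (one_sub_pow_seven_mul_pow_three_le hu) j
  have happ := abs_padeNum_sub_padeDen_le (7 * j) (3 * j) 37 (3 ^ 15) (by norm_num) (by norm_num)
    (by omega) hκ
  have hden := abs_padeDen_mul_le (7 * j) (3 * j) (d := 37) (B := 3 ^ 15 + 37)
    (by norm_num) (by norm_num)
  have hnum := not_two_pow_dvd_padeNum (7 * j) (3 * j) (d := 37) (A := 3 ^ 15) (by decide)
  set P := padeNum (7 * j) (3 * j) 37 (3 ^ 15)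
  set Q := padeDen (7 * j) (3 * j) 37 (3 ^ 15 + 37)
  have hs3 : √(3 : ℝ) * √3 = 3 := Real.mul_self_sqrt (by norm_num)
  have hsA : √(((3 ^ 15 : ℤ) : ℝ)) = 3 ^ 7 * √3 := by
    rw [Real.sqrt_eq_iff_mul_self_eq (by positivity) (by positivity)]
    push_cast
    linear_combination (-3 ^ 14 : ℝ) * hs3
  have hsB : √(((3 ^ 15 : ℤ) : ℝ) + ((37 : ℤ) : ℝ)) = 3788 := by
    rw [Real.sqrt_eq_iff_mul_self_eq (by positivity) (by positivity)]
    norm_num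
  rw [hsA, hsB, show 7 * j - 3 * j = 4 * j by omega, show 7 * j + 3 * j + 1 = 10 * j + 1 by ring]
    at happ
  rw [show 7 * j + 3 * j = 10 * j by ring] at hden
  push_cast at happ
  rw [show (14348907 : ℝ) = 3 ^ 15 by norm_num, ← pow_mul, ← pow_mul,
    show 15 * (4 * j) = 60 * j by ring, show 15 * (3 * j) = 45 * j by ring] at happ
  set W : ℝ := 3 ^ 7 * √3 * P - 3 ^ (60 * j) * 3788 * 4 ^ (4 * j) * Q
  -- This is `3 ^ r * √3 * W` with `√3 * 3 ^ k` replaced by `x`.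
  set Λ : ℤ := P * 3 ^ (r + 8) - 3788 * 4 ^ (4 * j) * Q * x
  have hΛ0 : Λ ≠ 0 := by
    intro h0
    -- Since `3788 = 4 * 947`, the `Q` term contains `2 ^ (8 * j + 2)`, more than the `2 ^ (7 * j +
    -- 1)` that cannot divide `P`.
    have h1 : P * 3 ^ (r + 8) = 2 ^ (7 * j + 1) * (2 ^ (j + 1) * 947 * Q * x) := by
      have h4 : (4 : ℤ) ^ (4 * j) = 2 ^ (7 * j) * 2 ^ j := by
        rw [← pow_add, show (4 : ℤ) = 2 ^ 2 by norm_num, ← pow_mul]; congr 1; ring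
      rw [pow_succ, pow_succ]
      linear_combination h0 + 3788 * Q * x * h4
    have hcop : IsCoprime ((2 : ℤ) ^ (7 * j + 1)) (3 ^ (r + 8)) :=
      IsCoprime.pow (by norm_num)
    exact hnum (hcop.dvd_of_dvd_mul_right ⟨_, h1⟩)
  have hΛ1 : (1 : ℝ) ≤ |(Λ : ℝ)| := by exact_mod_cast Int.one_le_abs hΛ0
  have hdecomp : (Λ : ℝ) = 3 ^ r * (√3 * W)
      + 3788 * 4 ^ (4 * j) * Q * (√3 * 3 ^ k - x) := by
    simp only [Λ, W]
    push_cast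
    rw [hkdef, pow_add, pow_add]
    linear_combination (-(3 ^ r * 3 ^ 7 : ℝ) * P) * hs3
  have hT1 : |(3 : ℝ) ^ r * (√3 * W)| ≤ 1 / 3 := by
    have h := remainder_term_le hj hr'
    rw [abs_mul, abs_mul, abs_of_pos (show (0 : ℝ) < 3 ^ r by positivity),
      abs_of_nonneg (Real.sqrt_nonneg 3)]
    refine le_of_mul_le_mul_right (a := ((3 : ℝ) ^ (45 * j) * 3 ^ 7)) ?_ (by positivity)
    refine le_trans ?_ h
    calc _ = (3 : ℝ) ^ r * (|W| * 3 ^ (45 * j) * (3 ^ 7 * √3)) := by ring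
      _ ≤ _ := by gcongr
  have hT2 : |(3788 : ℝ) * 4 ^ (4 * j) * Q * (√3 * 3 ^ k - x)| ≤ 1 / 3 := by
    have h := main_term_le (q := |(Q : ℝ)|) hj (show 60 * j + 30 ≤ k by omega)
      (show k ≤ 60 * j + 89 by omega) (by
        have : ((|Q| * (3 ^ 15 + 37) : ℤ) : ℝ) ≤ ((4 ^ (3 * j) * (10 * j).choose (7 * j)
          * (3 ^ 15 + 37 + 37) ^ (3 * j + 1) : ℤ) : ℝ) := by exact_mod_cast hden
        push_cast at this
        rwa [show (3 ^ 15 + 37 : ℝ) = 14348944 by norm_num,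
          show (3 ^ 15 + 74 : ℝ) = 14348981 by norm_num])
    rw [abs_mul, abs_mul, abs_mul, abs_of_pos (show (0 : ℝ) < 4 ^ (4 * j) by positivity),
      Nat.abs_ofNat]
    refine le_of_mul_le_mul_right (a := ((3 : ℝ) ^ k)) ?_ (by positivity)
    refine le_trans ?_ h
    rw [mul_assoc]
    gcongr
    exact abs_sqrt_three_mul_pow_sub_le hcon
  have := abs_add_le ((3 : ℝ) ^ r * (√3 * W)) (3788 * 4 ^ (4 * j) * Q * (√3 * 3 ^ k - x))
  rw [← hdecomp] at this
  linarith

theorem cube_add_lt_three_pow {k : ℕ} (hk : 7 ≤ k) : (2 * k) ^ 3 + 2 * k + 1 < 2 * 3 ^ k := by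
  induction k, hk using Nat.le_induction with
  | base => norm_num
  | succ k hk ih =>
    rw [pow_succ 3]
    nlinarith [Nat.mul_le_mul hk hk, Nat.mul_le_mul (Nat.mul_le_mul hk hk) hk,
      Nat.mul_le_mul_left (k * k) hk]

theorem two_mul_sub_one_le_abs_sq_sub_sq {y x : ℤ} (hy : 0 < y) (hx : 0 ≤ x) (h : y ^ 2 ≠ x ^ 2) :
    2 * y - 1 ≤ |y ^ 2 - x ^ 2| := by
  rcases lt_trichotomy y x with hlt | heq | hgt
  · rw [abs_of_nonpos (by nlinarith)]
    nlinarith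
  · exact absurd (by rw [heq]) h
  · rw [abs_of_nonneg (by nlinarith)]
    nlinarith

/-- Powers `3 ^ n` with `n ≥ 1381` differ from every square by more than `n ^ 3 + n`, unless they
are squares. -/
theorem lt_abs_three_pow_sub_sq {n : ℕ} (hn : 1381 ≤ n) (x : ℕ) (hne : (3 : ℤ) ^ n ≠ x ^ 2) :
    (n : ℤ) ^ 3 + n < |(3 : ℤ) ^ n - x ^ 2| := by
  rcases Nat.even_or_odd' n with ⟨k, rfl | rfl⟩
  · rw [mul_comm, pow_mul] at hne ⊢
    have h1 := two_mul_sub_one_le_abs_sq_sub_sq (by positivity) (by positivity) hne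
    have h2 : ((2 * k : ℤ)) ^ 3 + 2 * k + 1 < 2 * 3 ^ k := by
      exact_mod_cast cube_add_lt_three_pow (show 7 ≤ k by omega)
    push_cast
    linarith
  · have h := lt_abs_three_mul_nine_pow_sub_sq (show 690 ≤ k by omega) x
    have e : (3 : ℤ) ^ (2 * k + 1) = 3 * 9 ^ k := by rw [pow_succ, pow_mul]; ring
    rw [e]
    exact_mod_cast h

/-! ### Small exponents by quadratic residues -/

/-- Euler's criterion: `v` is a quadratic nonresidue modulo some small odd prime. -/
def hasSmallNonresidue (v : ℕ) : Bool :=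
  [3, 5, 7, 11, 13, 17, 19, 23, 29, 31, 37, 41, 43, 47].any
    fun p => (v % p) ^ ((p - 1) / 2) % p == p - 1

theorem hasSmallNonresidue_sq (x : ℕ) : hasSmallNonresidue (x ^ 2) = false := by
  have key : ∀ p : ℕ, p.Prime → 2 < p → ((x ^ 2 % p) ^ ((p - 1) / 2) % p == p - 1) = false := by
    intro p hp hp2
    rw [beq_eq_false_iff_ne]
    intro h
    have := Fact.mk hp
    have hodd : 2 * ((p - 1) / 2) = p - 1 := by
      have := hp.odd_of_ne_two (by omega)
      grind
    have h1 : (x : ZMod p) ^ (p - 1) = -1 := by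
      have h2 := congrArg (Nat.cast : ℕ → ZMod p) h
      rw [ZMod.natCast_mod, Nat.cast_pow, ZMod.natCast_mod, Nat.cast_pow, ← pow_mul, hodd,
        Nat.cast_sub hp.one_le] at h2
      simpa using h2
    have h3 : (1 : ZMod p) ≠ -1 := by
      have := Fact.mk hp2
      exact (ZMod.neg_one_ne_one).symm
    by_cases hx : (x : ZMod p) = 0
    · rw [hx, zero_pow (by omega)] at h1
      exact one_ne_zero (neg_eq_zero.mp h1.symm)
    · exact h3 ((ZMod.pow_card_sub_one_eq_one hx).symm.trans h1)
  unfold hasSmallNonresidue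
  rw [List.any_eq_false]
  intro p hp
  have : p.Prime ∧ 2 < p := by
    simp only [List.mem_cons, List.not_mem_nil, or_false] at hp
    rcases hp with rfl | rfl | rfl | rfl | rfl | rfl | rfl | rfl | rfl | rfl | rfl | rfl | rfl | rfl
      <;> norm_num
  simpa using key p this.1 this.2

theorem hasSmallNonresidue_add : ∀ n < 1381, 0 < n →
    hasSmallNonresidue (3 ^ n + (n ^ 3 + n)) = true := by
  decide +kernel

/-- The range starts at 4 because `n = 1` gives the solution and `n = 2, 3` give negative values.
The inequality makes the truncated subtraction faithful. -/
theorem hasSmallNonresidue_sub : ∀ n < 1381, 3 < n → n ^ 3 + n ≤ 3 ^ n ∧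
    hasSmallNonresidue (3 ^ n - (n ^ 3 + n)) = true := by
  decide +kernel

theorem theorem2 :
    (∀ n x : ℕ, 0 < n → 0 < x →
      (3 : ℤ) ^ n + ((n : ℤ) ^ 3 + (n : ℤ)) ≠ (x : ℤ) ^ 2) ∧
    (∀ n x : ℕ, 0 < n → 0 < x →
      ((3 : ℤ) ^ n - ((n : ℤ) ^ 3 + (n : ℤ)) = (x : ℤ) ^ 2 ↔ n = 1 ∧ x = 1)) := by
  refine ⟨fun n x hn _ h => ?_, fun n x hn hx => ⟨fun h => ?_, ?_⟩⟩
  · have hpos : (0 : ℤ) < (n : ℤ) ^ 3 + n := by positivity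
    rcases lt_or_ge n 1381 with hlt | hge
    · have h1 : 3 ^ n + (n ^ 3 + n) = x ^ 2 := by exact_mod_cast h
      have h2 := hasSmallNonresidue_add n hlt hn
      rw [h1, hasSmallNonresidue_sq] at h2
      exact Bool.false_ne_true h2
    · have h1 := lt_abs_three_pow_sub_sq hge x (by linarith)
      rw [abs_of_nonpos (by linarith)] at h1
      linarith
  · have hpos : (0 : ℤ) < (n : ℤ) ^ 3 + n := by positivity
    rcases lt_or_ge n 1381 with hlt | hge
    · rcases le_or_gt n 3 with h3 | h3
      · interval_cases n
        · refine ⟨rfl, ?_⟩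
          have : (x : ℤ) ^ 2 = 1 := by rw [← h]; norm_num
          have h1 : x ^ 2 = 1 := by exact_mod_cast this
          simpa using h1
        · norm_num at h
          nlinarith [sq_nonneg (x : ℤ)]
        · norm_num at h
          nlinarith [sq_nonneg (x : ℤ)]
      · obtain ⟨hle, h2⟩ := hasSmallNonresidue_sub n hlt h3
        have h1 : 3 ^ n - (n ^ 3 + n) = x ^ 2 := by
          zify [hle]
          exact h
        rw [h1, hasSmallNonresidue_sq] at h2
        exact absurd h2 Bool.false_ne_true
    · have h1 := lt_abs_three_pow_sub_sq hge x (by linarith)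
      rw [abs_of_nonneg (by linarith)] at h1
      linarith
  · rintro ⟨rfl, rfl⟩
    norm_num
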